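/- Let $D_{n,p}$ be the binomial random digraph on $n$ vertices: each of the $n(n-1)$ ordered pairs of distinct vertices is a directed edge with probability $p$, independently of the others (no loops). For a digraph $D$ on $n$ vertices let $\Delta_1(D)\ge \Delta_2(D)\ge\dots\ge\Delta_{2n}(D)$ be the list of all $n$ out-degrees and all $n$ in-degrees of the vertices of $D$, with repetitions, in nonincreasing order. Let $p=p(n)$ be any sequence with $p(n)\in[0,1]$ and $\frac{\log^{10} n}{n}\le p(n)\le \frac12$ for all sufficiently large $n$, where $\log$ is the natural logarithm. Then $$\lim_{n\to\infty}\Pr\left[\Delta_1(D_{n,p(n)})-\Delta_2(D_{n,p(n)})\ \ge\ \frac{\sqrt{n\,p(n)}}{2\log n}\right]=1 .$$ -/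

import Mathlib

open MeasureTheory ProbabilityTheory

namespace Digraph

variable {V : Type*}

/-- The out-degree of `v`: the number of vertices `w` with an edge from `v` to `w`. -/
noncomputable def outDegree (D : Digraph V) (v : V) : ℕ := {w | D.Adj v w}.ncard

/-- The in-degree of `v`: the number of vertices `w` with an edge from `w` to `v`. -/
noncomputable def inDegree (D : Digraph V) (v : V) : ℕ := {w | D.Adj w v}.ncard

/-- The list of all out-degrees and all in-degrees of `D` (two entries for each vertex, with
repetitions), sorted in nonincreasing order. -/
noncomputable def degreeSequence [Fintype V] (D : Digraph V) : List ℕ :=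
  ((Finset.univ : Finset V).val.map D.outDegree +
    (Finset.univ : Finset V).val.map D.inDegree).sort (fun a b => b ≤ a)

theorem length_degreeSequence [Fintype V] (D : Digraph V) :
    D.degreeSequence.length = 2 * Fintype.card V := by
  simp [degreeSequence, two_mul]

/-- `D.orderedDegree i` is the `i`-th largest entry of the combined in/out-degree sequence, where
`i = 1` gives the largest one; it is meant for `1 ≤ i ≤ 2 * Fintype.card V`. -/
noncomputable def orderedDegree [Fintype V] (D : Digraph V) (i : ℕ) : ℕ :=
  D.degreeSequence.getD (i - 1) 0

/-- The digraph whose edges are the pairs in `S`. -/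
def ofEdgeSet (S : Set (V × V)) : Digraph V where
  Adj v w := (v, w) ∈ S

/-- The product σ-algebra on adjacency relations; it contains all sets if `V` is finite. -/
instance instMeasurableSpaceDigraph : MeasurableSpace (Digraph V) :=
  MeasurableSpace.comap Digraph.Adj inferInstance

theorem measurable_ofEdgeSet : Measurable (ofEdgeSet : Set (V × V) → Digraph V) := by
  rw [measurable_comap_iff]
  refine measurable_pi_iff.2 fun v => measurable_pi_iff.2 fun w => ?_
  exact measurable_set_mem (v, w)

/-- The law of the binomial random digraph with vertex set `V`: each ordered pair of distinct
vertices is an edge with probability `p`, independently of the others, and there are no loops. -/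
noncomputable def binomialRandom (V : Type*) (p : unitInterval) : Measure (Digraph V) :=
  (setBernoulli {e : V × V | e.1 ≠ e.2} p).map ofEdgeSet

instance instIsProbabilityMeasureBinomialRandom (p : unitInterval) :
    IsProbabilityMeasure (binomialRandom V p) :=
  Measure.isProbabilityMeasure_map measurable_ofEdgeSet.aemeasurable

end Digraph

/-! Write μ = np. Degrees are binomial with N = n - 1 trials, and near the expected maximum, about
√(μ log n) above the mean, consecutive binomial weights have ratio 1 - O(√(log n / μ)). So the
weights stay within a factor 2 over a window of J ≈ √(μ / log n) / 80, whereas the required gap G ≈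
√μ / (2 log n) is shorter than J by a factor of order √(log n).

Fix a large constant W. `exists_binomial_threshold` gives K for which the expected number of
out-degrees at least K + 1 + G is at least W, while the tail at K is still at most 3W/n and the
single weight at K at most 6W/(nJ). Out-degrees are independent, so some degree reaches K + 1 + G
except with probability at most exp(-W). Two different degrees share at most one potential edge;
deleting it makes them independent, so both exceed K and differ by at most G with probability O(W² G
/ (n² J)). A union bound over at most (2n)² pairs costs O(W² / √(log n)). Outside both bad events
the two largest degrees differ by more than G. Let n tend to infinity, with W chosen beforehand
according to the desired error. -/

/-- The probability that a binomial random variable with parameters `N`, `p` equals `k`. -/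
noncomputable def binomialWeight (N : ℕ) (p : ℝ) (k : ℕ) : ℝ :=
  N.choose k * p ^ k * (1 - p) ^ (N - k)

/-- The probability that a binomial random variable with parameters `N`, `p` is at least `k`. -/
noncomputable def binomialTail (N : ℕ) (p : ℝ) (k : ℕ) : ℝ :=
  ∑ j ∈ Finset.Ico k (N + 1), binomialWeight N p j

/-! ### Shape of the binomial distribution -/

section BinomialWeight

variable {N : ℕ} {p : ℝ}

theorem binomialWeight_nonneg (h0 : 0 ≤ p) (h1 : p ≤ 1) (k : ℕ) : 0 ≤ binomialWeight N p k := by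
  have : 0 ≤ 1 - p := by linarith
  unfold binomialWeight
  positivity

theorem binomialWeight_eq_zero {k : ℕ} (hk : N < k) : binomialWeight N p k = 0 := by
  simp [binomialWeight, Nat.choose_eq_zero_of_lt hk]

theorem sum_binomialWeight (N : ℕ) (p : ℝ) :
    ∑ k ∈ Finset.range (N + 1), binomialWeight N p k = 1 := by
  have h := add_pow p (1 - p) N
  rw [add_sub_cancel, one_pow] at h
  rw [h]
  exact Finset.sum_congr rfl fun k _ => by unfold binomialWeight; ring

/-- The ratio of consecutive weights, cleared of denominators so that it also holds for k ≥ N.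
Monotonicity and all decay rates below come from it. -/
theorem binomialWeight_succ_mul (N : ℕ) (p : ℝ) (k : ℕ) :
    (k + 1) * (1 - p) * binomialWeight N p (k + 1) = (N - k) * p * binomialWeight N p k := by
  rcases lt_or_ge k N with hk | hk
  · have h1 : ((N.choose (k + 1) : ℕ) : ℝ) * (k + 1) = N.choose k * (N - k) := by
      have := Nat.choose_succ_right_eq N k
      rw [← Nat.cast_sub hk.le]
      exact_mod_cast this
    have h2 : (1 - p) ^ (N - k) = (1 - p) ^ (N - (k + 1)) * (1 - p) := by
      rw [← pow_succ]; congr 1; omega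
    unfold binomialWeight
    rw [h2, pow_succ]
    linear_combination (p ^ k * p * (1 - p) ^ (N - (k + 1)) * (1 - p)) * h1
  · rw [binomialWeight_eq_zero (Nat.lt_succ_of_le hk)]
    rcases hk.eq_or_lt with rfl | hk
    · simp
    · rw [binomialWeight_eq_zero hk]; simp

theorem binomialWeight_succ_succ (N : ℕ) (p : ℝ) (k : ℕ) :
    binomialWeight (N + 1) p (k + 1) =
      p * binomialWeight N p k + (1 - p) * binomialWeight N p (k + 1) := by
  rcases lt_or_ge k N with hk | hk
  · have h2 : (1 - p) ^ (N - k) = (1 - p) ^ (N - (k + 1)) * (1 - p) := by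
      rw [← pow_succ]; congr 1; omega
    unfold binomialWeight
    rw [Nat.choose_succ_succ, Nat.add_sub_add_right, h2]
    push_cast
    ring
  · rw [binomialWeight_eq_zero (Nat.lt_succ_of_le hk)]
    unfold binomialWeight
    rw [Nat.choose_succ_succ, Nat.add_sub_add_right, Nat.choose_eq_zero_of_lt (Nat.lt_succ_of_le hk)]
    push_cast
    ring

/-- An additional trial fails with probability 1 - p ≥ 1/2. This absorbs the loss of one shared edge
later on. -/
theorem binomialWeight_le_two_mul_succ (h0 : 0 ≤ p) (h1 : p ≤ 1 / 2) (k : ℕ) :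
    binomialWeight N p k ≤ 2 * binomialWeight (N + 1) p k := by
  have hn (j) := binomialWeight_nonneg (N := N) h0 (by linarith : p ≤ 1) j
  cases k with
  | zero =>
    have := hn 0
    have h : binomialWeight (N + 1) p 0 = (1 - p) * binomialWeight N p 0 := by
      simp [binomialWeight, pow_succ]; ring
    rw [h]; nlinarith
  | succ k =>
    rw [binomialWeight_succ_succ]
    nlinarith [hn k, hn (k + 1), mul_nonneg h0 (hn k)]

theorem binomialWeight_succ_le (h0 : 0 ≤ p) (h1 : p ≤ 1 / 2) {k : ℕ}
    (hk : (N + 1) * p ≤ k + 1) : binomialWeight N p (k + 1) ≤ binomialWeight N p k := by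
  have hn := binomialWeight_nonneg (N := N) h0 (by linarith : p ≤ 1) k
  have hr := binomialWeight_succ_mul N p k
  have hk' : (0 : ℝ) < (k + 1) * (1 - p) := mul_pos (by positivity) (by linarith)
  refine le_of_mul_le_mul_left ?_ hk'
  rw [hr]
  exact mul_le_mul_of_nonneg_right (by nlinarith) hn

theorem binomialWeight_le_succ (h0 : 0 ≤ p) (h1 : p ≤ 1 / 2) {k : ℕ}
    (hk : k + 1 ≤ (N + 1) * p) : binomialWeight N p k ≤ binomialWeight N p (k + 1) := by
  have hn := binomialWeight_nonneg (N := N) h0 (by linarith : p ≤ 1) k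
  have hr := binomialWeight_succ_mul N p k
  have hk' : (0 : ℝ) < (k + 1) * (1 - p) := mul_pos (by positivity) (by linarith)
  refine le_of_mul_le_mul_left ?_ hk'
  rw [hr]
  exact mul_le_mul_of_nonneg_right (by nlinarith) hn

theorem binomialWeight_antitone (h0 : 0 ≤ p) (h1 : p ≤ 1 / 2) {k l : ℕ}
    (hk : (N + 1) * p ≤ k + 1) (hkl : k ≤ l) : binomialWeight N p l ≤ binomialWeight N p k := by
  induction l, hkl using Nat.le_induction with
  | base => rfl
  | succ l hl ih =>
    refine (binomialWeight_succ_le h0 h1 ?_).trans ih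
    have : (k : ℝ) ≤ l := by exact_mod_cast hl
    linarith

theorem binomialWeight_monotone (h0 : 0 ≤ p) (h1 : p ≤ 1 / 2) {k l : ℕ}
    (hl : l ≤ (N + 1) * p) (hkl : k ≤ l) : binomialWeight N p k ≤ binomialWeight N p l := by
  induction l, hkl using Nat.le_induction with
  | base => rfl
  | succ l hkl ih =>
    push_cast at hl
    exact (ih (by linarith)).trans (binomialWeight_le_succ h0 h1 hl)

theorem binomialWeight_le_mode (h0 : 0 ≤ p) (h1 : p ≤ 1 / 2) (k : ℕ) :
    binomialWeight N p k ≤ binomialWeight N p ⌊(N + 1) * p⌋₊ := by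
  rcases le_total k ⌊(N + 1) * p⌋₊ with h | h
  · exact binomialWeight_monotone h0 h1 (Nat.floor_le (by positivity)) h
  · exact binomialWeight_antitone h0 h1 (Nat.lt_floor_add_one _).le h

/-- The N + 1 weights sum to 1 and none exceeds the one at the mode. -/
theorem one_le_mul_binomialWeight_mode (h0 : 0 ≤ p) (h1 : p ≤ 1 / 2) :
    1 ≤ (N + 1) * binomialWeight N p ⌊(N + 1) * p⌋₊ := by
  refine (sum_binomialWeight N p).ge.trans ?_
  refine (Finset.sum_le_card_nsmul _ _ _ fun k _ => binomialWeight_le_mode h0 h1 k).trans ?_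
  simp

theorem sum_le_binomialTail (h0 : 0 ≤ p) (h1 : p ≤ 1) {k : ℕ} {s : Finset ℕ}
    (hs : ∀ j ∈ s, k ≤ j) : ∑ j ∈ s, binomialWeight N p j ≤ binomialTail N p k := by
  classical
  have : ∑ j ∈ s, binomialWeight N p j = ∑ j ∈ s with j < N + 1, binomialWeight N p j := by
    rw [Finset.sum_filter]
    refine Finset.sum_congr rfl fun j _ => ?_
    split_ifs with h
    · rfl
    · exact binomialWeight_eq_zero (by omega)
  rw [this]
  refine Finset.sum_le_sum_of_subset_of_nonneg (fun j hj => ?_)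
    fun j _ _ => binomialWeight_nonneg h0 h1 j
  rw [Finset.mem_filter] at hj
  exact Finset.mem_Ico.2 ⟨hs j hj.1, hj.2⟩

theorem binomialTail_nonneg (h0 : 0 ≤ p) (h1 : p ≤ 1) (k : ℕ) : 0 ≤ binomialTail N p k :=
  Finset.sum_nonneg fun j _ => binomialWeight_nonneg h0 h1 j

theorem binomialTail_eq_zero {k : ℕ} (hk : N < k) : binomialTail N p k = 0 := by
  rw [binomialTail, Finset.Ico_eq_empty (by omega), Finset.sum_empty]

theorem binomialTail_le_sum_add (h0 : 0 ≤ p) (h1 : p ≤ 1) (k J : ℕ) :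
    binomialTail N p k ≤ ∑ j ∈ Finset.range J, binomialWeight N p (k + j) +
      binomialTail N p (k + J) := by
  classical
  have h : Finset.Ico k (N + 1) ⊆ Finset.Ico k (k + J) ∪ Finset.Ico (k + J) (N + 1) := by
    intro j; simp only [Finset.mem_union, Finset.mem_Ico]; omega
  have h2 : Disjoint (Finset.Ico k (k + J)) (Finset.Ico (k + J) (N + 1)) := by
    rw [Finset.disjoint_left]; intro j; simp only [Finset.mem_Ico]; omega
  refine (Finset.sum_le_sum_of_subset_of_nonneg h
    fun j _ _ => binomialWeight_nonneg h0 h1 j).trans ?_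
  rw [Finset.sum_union h2, Finset.sum_Ico_eq_sum_range, Nat.add_sub_cancel_left]
  rfl

theorem sum_range_le_binomialTail (h0 : 0 ≤ p) (h1 : p ≤ 1) (k J : ℕ) :
    ∑ j ∈ Finset.range J, binomialWeight N p (k + j) ≤ binomialTail N p k := by
  have := sum_le_binomialTail (N := N) (k := k) h0 h1 (s := Finset.Ico k (k + J))
    fun j hj => (Finset.mem_Ico.1 hj).1
  rwa [Finset.sum_Ico_eq_sum_range, Nat.add_sub_cancel_left] at this

/-- The weights decrease slowly close to the mean. -/
theorem mul_binomialWeight_le_succ (h0 : 0 < p) (h1 : p ≤ 1 / 2) {k : ℕ} {Y : ℝ} (hY0 : 0 ≤ Y)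
    (hk : (N + 1) * p ≤ k + 1) (hY : k + 1 ≤ (N + 1) * p + Y) :
    (1 - 2 * Y / ((N + 1) * p)) * binomialWeight N p k ≤ binomialWeight N p (k + 1) := by
  have hn := binomialWeight_nonneg (N := N) h0.le (by linarith : p ≤ 1) k
  have hr := binomialWeight_succ_mul N p k
  have hk' : (0 : ℝ) < (k + 1) * (1 - p) := mul_pos (by positivity) (by linarith)
  have hmu : (0 : ℝ) < (N + 1) * p := by positivity
  refine le_of_mul_le_mul_left ?_ hk'
  rw [hr, ← mul_assoc]
  refine mul_le_mul_of_nonneg_right ?_ hn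
  -- The factor 2 compensates for 1 - p ≥ 1/2.
  have h3 : (k + 1) * (1 - p) * (2 * Y / ((N + 1) * p)) ≥ Y := by
    rw [mul_div_assoc', ge_iff_le, le_div_iff₀ hmu]
    have : (N + 1) * p * 1 ≤ (k + 1) * (2 * (1 - p)) :=
      mul_le_mul hk (by linarith) (by norm_num) (by positivity)
    nlinarith
  nlinarith

theorem pow_mul_binomialWeight_le (h0 : 0 < p) (h1 : p ≤ 1 / 2) {k j : ℕ} {Y : ℝ} (hY0 : 0 ≤ Y)
    (hY1 : 2 * Y / ((N + 1) * p) ≤ 1)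
    (hk : (N + 1) * p ≤ k + 1) (hY : k + j ≤ (N + 1) * p + Y) :
    (1 - 2 * Y / ((N + 1) * p)) ^ j * binomialWeight N p k ≤ binomialWeight N p (k + j) := by
  induction j with
  | zero => simp
  | succ j ih =>
    push_cast at hY
    have h := ih (by linarith)
    have h2 := mul_binomialWeight_le_succ (N := N) h0 h1 (k := k + j) hY0
      (by push_cast; linarith [(Nat.cast_nonneg j : (0 : ℝ) ≤ j)]) (by push_cast; linarith)
    rw [pow_succ, mul_right_comm, mul_comm]
    exact (mul_le_mul_of_nonneg_left h (by linarith)).trans h2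

/-- By Bernoulli's inequality the product of j slow ratios is at least 1/2. -/
theorem binomialWeight_le_two_mul (h0 : 0 < p) (h1 : p ≤ 1 / 2) {k j : ℕ} {Y : ℝ} (hY0 : 0 ≤ Y)
    (hY1 : 2 * Y / ((N + 1) * p) ≤ 1) (hjY : j * (2 * Y / ((N + 1) * p)) ≤ 1 / 2)
    (hk : (N + 1) * p ≤ k + 1) (hY : k + j ≤ (N + 1) * p + Y) :
    binomialWeight N p k ≤ 2 * binomialWeight N p (k + j) := by
  have hn := binomialWeight_nonneg (N := N) h0.le (by linarith : p ≤ 1) k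
  have h := pow_mul_binomialWeight_le h0 h1 hY0 hY1 hk hY
  have hb := one_add_mul_le_pow (a := -(2 * Y / ((N + 1) * p))) (by linarith) j
  rw [← sub_eq_add_neg] at hb
  have : (1 / 2 : ℝ) * binomialWeight N p k ≤
      (1 - 2 * Y / ((N + 1) * p)) ^ j * binomialWeight N p k :=
    mul_le_mul_of_nonneg_right (by linarith) hn
  linarith

/-- The weights decrease fast far above the mean. -/
theorem binomialWeight_succ_le_mul (h0 : 0 < p) (h1 : p ≤ 1 / 2) {k : ℕ} {s : ℝ} (hs : 0 ≤ s)
    (hk : (N + 1) * p + s ≤ k + 1) (hk2 : k + 1 ≤ 2 * ((N + 1) * p)) :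
    binomialWeight N p (k + 1) ≤ (1 - s / (2 * ((N + 1) * p))) * binomialWeight N p k := by
  have hn := binomialWeight_nonneg (N := N) h0.le (by linarith : p ≤ 1) k
  have hr := binomialWeight_succ_mul N p k
  have hk' : (0 : ℝ) < (k + 1) * (1 - p) := mul_pos (by positivity) (by linarith)
  have hmu : (0 : ℝ) < 2 * ((N + 1) * p) := by positivity
  refine le_of_mul_le_mul_left ?_ hk'
  rw [hr, ← mul_assoc]
  refine mul_le_mul_of_nonneg_right ?_ hn
  have h3 : (k + 1) * (1 - p) * (s / (2 * ((N + 1) * p))) ≤ s := by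
    rw [mul_div_assoc', div_le_iff₀ hmu, mul_comm]
    refine mul_le_mul_of_nonneg_left ?_ hs
    nlinarith
  nlinarith

theorem binomialWeight_le_one (h0 : 0 ≤ p) (h1 : p ≤ 1) (k : ℕ) : binomialWeight N p k ≤ 1 := by
  have := sum_le_binomialTail (N := N) (k := 0) h0 h1 (s := {k}) (by simp)
  rw [Finset.sum_singleton, binomialTail, ← Finset.range_eq_Ico, sum_binomialWeight] at this
  exact this

theorem binomialWeight_le_exp (h0 : 0 < p) (h1 : p ≤ 1 / 2) {k j : ℕ} {s : ℝ} (hs : 0 ≤ s)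
    (hk : (N + 1) * p + s ≤ k + 1) (hk2 : k + j ≤ 2 * ((N + 1) * p)) :
    binomialWeight N p (k + j) ≤ Real.exp (-(j * (s / (2 * ((N + 1) * p))))) := by
  induction j with
  | zero => simpa using binomialWeight_le_one h0.le (by linarith) k
  | succ j ih =>
    push_cast at hk2
    have h := ih (by linarith)
    have h2 := binomialWeight_succ_le_mul (N := N) h0 h1 (k := k + j) hs
      (by push_cast; linarith [(Nat.cast_nonneg j : (0 : ℝ) ≤ j)]) (by push_cast; linarith)
    have hn := binomialWeight_nonneg (N := N) h0.le (by linarith : p ≤ 1) (k + j)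
    have he := Real.add_one_le_exp (-(s / (2 * ((N + 1) * p))))
    rw [← add_assoc]
    calc _ ≤ _ := h2
      _ ≤ Real.exp (-(s / (2 * ((N + 1) * p)))) * Real.exp (-(j * (s / (2 * ((N + 1) * p))))) :=
        mul_le_mul (by linarith) h hn (Real.exp_pos _).le
      _ = _ := by rw [← Real.exp_add]; congr 1; push_cast; ring

theorem binomialTail_le_mul (h0 : 0 ≤ p) (h1 : p ≤ 1 / 2) {k : ℕ} (hk : (N + 1) * p ≤ k + 1) :
    binomialTail N p k ≤ (N + 1) * binomialWeight N p k := by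
  have hn := binomialWeight_nonneg (N := N) h0 (by linarith : p ≤ 1) k
  refine (Finset.sum_le_card_nsmul _ _ _ fun j hj =>
    binomialWeight_antitone h0 h1 hk (Finset.mem_Ico.1 hj).1).trans ?_
  rw [nsmul_eq_mul, Nat.card_Ico]
  refine mul_le_mul_of_nonneg_right ?_ hn
  exact_mod_cast Nat.sub_le _ _

theorem binomialTail_anti (h0 : 0 ≤ p) (h1 : p ≤ 1) {k l : ℕ} (hkl : k ≤ l) :
    binomialTail N p l ≤ binomialTail N p k :=
  sum_le_binomialTail h0 h1 fun _ hj => hkl.trans (Finset.mem_Ico.1 hj).1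

end BinomialWeight

/-! ### The degree threshold -/

section BinomialThreshold

variable {N : ℕ} {p : ℝ}

/-- Beyond μ + 3r each step multiplies the weight by at most 1 - 3r/(2μ). A further 3r steps give
exp(-9r²/(2μ)) = (N + 1)^(-9/2), which beats the at most N + 1 terms of the tail. The two roundings
fit into the remaining 3r because r ≥ 2. -/
theorem binomialTail_lt_of_far (h0 : 0 < p) (h1 : p ≤ 1 / 2) {r : ℝ}
    (hlog : 0 < Real.log (N + 1)) (hr2 : r ^ 2 = (N + 1) * p * Real.log (N + 1)) (hr : 2 ≤ r)
    (hr20 : 20 * r ≤ (N + 1) * p) {k : ℕ} (hk : (N + 1) * p + 9 * r ≤ k) :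
    binomialTail N p k < 1 / (N + 1) := by
  have hmu : (0 : ℝ) < (N + 1) * p := by positivity
  set μ : ℝ := (N + 1) * p with hμ
  set k₀ : ℕ := ⌈μ + 3 * r⌉₊
  set j : ℕ := ⌈3 * r⌉₊
  have hk₀ : μ + 3 * r ≤ k₀ := Nat.le_ceil _
  have hk₀' : (k₀ : ℝ) < μ + 3 * r + 1 := Nat.ceil_lt_add_one (by positivity)
  have hj : 3 * r ≤ j := Nat.le_ceil _
  have hj' : (j : ℝ) < 3 * r + 1 := Nat.ceil_lt_add_one (by positivity)
  have hle : k₀ + j ≤ k := by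
    have : ((k₀ + j : ℕ) : ℝ) ≤ k := by push_cast; linarith
    exact_mod_cast this
  have hq := binomialWeight_le_exp (N := N) h0 h1 (k := k₀) (j := j) (s := 3 * r) (by positivity)
    (by rw [← hμ]; linarith) (by rw [← hμ]; linarith)
  rw [← hμ] at hq
  have hexp : Real.exp (-(j * (3 * r / (2 * μ)))) < ((N : ℝ) + 1)⁻¹ * ((N : ℝ) + 1)⁻¹ := by
    have hN : (0 : ℝ) < N + 1 := by positivity
    rw [← Real.exp_log (inv_pos.2 hN), ← Real.exp_add, Real.exp_lt_exp, Real.log_inv]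
    have : (3 * r) * (3 * r / (2 * μ)) = 9 / 2 * Real.log (N + 1) := by
      field_simp
      rw [hr2]; ring
    have h2 : (3 * r) * (3 * r / (2 * μ)) ≤ j * (3 * r / (2 * μ)) :=
      mul_le_mul_of_nonneg_right hj (by positivity)
    linarith
  calc binomialTail N p k ≤ binomialTail N p (k₀ + j) := binomialTail_anti h0.le (by linarith) hle
    _ ≤ (N + 1) * binomialWeight N p (k₀ + j) := by
      refine binomialTail_le_mul h0.le h1 ?_
      push_cast
      rw [← hμ]; linarith
    _ < (N + 1) * (((N : ℝ) + 1)⁻¹ * ((N : ℝ) + 1)⁻¹) :=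
      mul_lt_mul_of_pos_left (hq.trans_lt hexp) (by positivity)
    _ = 1 / (N + 1) := by field_simp

theorem exists_binomial_threshold (h0 : 0 < p) (h1 : p ≤ 1 / 2) {r W : ℝ} {G J : ℕ}
    (hlog : 1 ≤ Real.log (N + 1)) (hr2 : r ^ 2 = (N + 1) * p * Real.log (N + 1)) (hr : 2 ≤ r)
    (hr20 : 20 * r ≤ (N + 1) * p) (hJr : 80 * J * r ≤ (N + 1) * p) (hGJ : G + 2 ≤ J)
    (hW : 1 ≤ W) (hWJ : 2 * W ≤ J) :
    ∃ K : ℕ, (N + 1) * p ≤ K + 1 ∧ W / (N + 1) ≤ binomialTail N p (K + 1 + G) ∧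
      binomialTail N p K ≤ 3 * W / (N + 1) ∧ J * binomialWeight N p K ≤ 6 * W / (N + 1) := by
  have hp1 : p ≤ 1 := by linarith
  have hmu : (0 : ℝ) < (N + 1) * p := by positivity
  have hmode := one_le_mul_binomialWeight_mode (N := N) h0.le h1
  set μ : ℝ := (N + 1) * p with hμ
  set m : ℕ := ⌊μ⌋₊
  have hm : μ < m + 1 := Nat.lt_floor_add_one _
  have hm' : (m : ℝ) ≤ μ := Nat.floor_le hmu.le
  have hN : (0 : ℝ) < N + 1 := by positivity
  -- Two windows of length J starting below μ + 9r thus stay below μ + 10r, the range used for the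
  -- slow decay.
  have hJ : 2 * (J : ℝ) ≤ r := by
    have : 80 * J * r ≤ r * r := by
      rw [← pow_two, hr2]; nlinarith
    have := le_of_mul_le_mul_right this (by linarith)
    have h0J : (0 : ℝ) ≤ J := by positivity
    linarith
  have slow : ∀ k j : ℕ, μ ≤ k + 1 → (k : ℝ) ≤ μ + 9 * r → j ≤ 2 * J →
      binomialWeight N p k ≤ 2 * binomialWeight N p (k + j) := by
    intro k j hk hk' hj
    have hj' : (j : ℝ) ≤ 2 * J := by exact_mod_cast hj
    refine binomialWeight_le_two_mul h0 h1 (Y := 10 * r) (by linarith) ?_ ?_ hk ?_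
    · rw [← hμ, div_le_one hmu]; linarith
    -- With Y = 10r the accumulated loss is at most 2J · 20r/μ = 40Jr/μ ≤ 1/2; this is the origin of
    -- the 80 in `hJr`.
    · rw [← hμ, mul_div_assoc', div_le_iff₀ hmu]; nlinarith
    · rw [← hμ]; linarith
  have sumslow : ∀ k i : ℕ, μ ≤ k + 1 → (k : ℝ) ≤ μ + 9 * r → i ≤ J →
      J * binomialWeight N p k ≤ 2 * binomialTail N p (k + i) := by
    intro k i hk hk' hi
    have h := sum_range_le_binomialTail (N := N) h0.le hp1 (k + i) J
    have h2 : J * binomialWeight N p k ≤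
        2 * ∑ j ∈ Finset.range J, binomialWeight N p (k + i + j) := by
      rw [Finset.mul_sum]
      refine le_trans (le_of_eq ?_) (Finset.card_nsmul_le_sum _ _ (binomialWeight N p k) ?_)
      · simp
      · intro j hj
        rw [add_assoc]
        exact slow k _ hk hk' (by have := Finset.mem_range.1 hj; omega)
    linarith
  -- At the mode the weight is at least 1/(N + 1), and J ≥ 2W weights of comparable size follow.
  have hmT : W / (N + 1) ≤ binomialTail N p (m + 1 + G) := by
    have h := sumslow m (1 + G) hm.le (by linarith) (by omega)
    rw [← add_assoc] at h
    rw [div_le_iff₀ hN]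
    nlinarith
  have hex : ∃ i, binomialTail N p (m + i + 2 + G) < W / (N + 1) :=
    ⟨N, by rw [binomialTail_eq_zero (by omega)]; positivity⟩
  classical
  -- K is the last point before the shifted tail first falls below W/(N + 1); the search starts at
  -- the mode.
  obtain ⟨K, hKm, hK1, hK2⟩ : ∃ K, m ≤ K ∧ W / (N + 1) ≤ binomialTail N p (K + 1 + G) ∧
      binomialTail N p (K + 2 + G) < W / (N + 1) := by
    refine ⟨m + Nat.find hex, by omega, ?_, Nat.find_spec hex⟩
    rcases h : Nat.find hex with _ | i
    · exact hmT
    · have := Nat.find_min hex (m := i) (by omega)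
      rw [not_lt] at this
      rwa [show m + (i + 1) + 1 + G = m + i + 2 + G by omega]
  have hKm' : (m : ℝ) ≤ K := by exact_mod_cast hKm
  have hKμ : μ ≤ K + 1 := by linarith
  have hKr : (K : ℝ) ≤ μ + 9 * r := by
    by_contra! hc
    have h := binomialTail_lt_of_far (N := N) h0 h1 (by linarith) hr2 hr hr20 (k := K + 1 + G)
      (by push_cast; linarith [(Nat.cast_nonneg G : (0 : ℝ) ≤ G)])
    have : 1 / ((N : ℝ) + 1) ≤ W / (N + 1) := by gcongr
    linarith
  -- The block of G + 2 weights from K is at most twice the next block, which is part of the tail at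
  -- K + 2 + G. Hence the tail at K is at most three times that tail.
  have hT : binomialTail N p K ≤ 3 * W / (N + 1) := by
    have h := binomialTail_le_sum_add (N := N) h0.le hp1 K (2 + G)
    have h2 := sum_range_le_binomialTail (N := N) h0.le hp1 (K + (2 + G)) (2 + G)
    have h3 : ∑ j ∈ Finset.range (2 + G), binomialWeight N p (K + j) ≤
        2 * ∑ j ∈ Finset.range (2 + G), binomialWeight N p (K + (2 + G) + j) := by
      rw [Finset.mul_sum]
      refine Finset.sum_le_sum fun j hj => ?_
      have hj := Finset.mem_range.1 hj
      refine (binomialWeight_antitone h0.le h1 hKμ (Nat.le_add_right K j)).trans ?_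
      rw [add_assoc]
      exact slow K _ hKμ hKr (by omega)
    rw [← add_assoc] at h h2 h3
    rw [mul_div_assoc]
    linarith
  refine ⟨K, hKμ, hK1, hT, ?_⟩
  have h := sumslow K 0 hKμ hKr (by omega)
  rw [add_zero] at h
  rw [mul_div_assoc] at hT ⊢
  linarith

end BinomialThreshold

/-! ### Independence and binomial counts for random subsets -/

theorem ProbabilityTheory.IndepFun.measureReal_inter_preimage {Ω β γ : Type*}
    [MeasurableSpace Ω] [MeasurableSpace β] [MeasurableSpace γ] {μ : Measure Ω} {f : Ω → β}
    {g : Ω → γ} (h : IndepFun f g μ) {s : Set β} {t : Set γ} (hs : MeasurableSet s)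
    (ht : MeasurableSet t) : μ.real (f ⁻¹' s ∩ g ⁻¹' t) = μ.real (f ⁻¹' s) * μ.real (g ⁻¹' t) := by
  simp only [measureReal_def, h.measure_inter_preimage_eq_mul s t hs ht, ENNReal.toReal_mul]

section SetBernoulli

variable {ι : Type*} (u : Set ι) (p : unitInterval)

theorem iIndepFun_mem_setBernoulli :
    iIndepFun (fun (i : ι) (s : Set ι) => i ∈ s) (setBernoulli u p) := by
  have hm (i : ι) : Measurable fun s : Set ι => i ∈ s := measurable_set_mem i
  have hset : Measurable fun q : ι → Prop => {i | q i} := MeasurableEquiv.setOfPred.measurable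
  rw [iIndepFun_iff_map_fun_eq_infinitePi_map hm, setBernoulli_eq_map,
    Measure.map_map (measurable_pi_lambda _ hm) hset]
  refine Measure.map_id.trans ?_
  congr 1
  funext i
  rw [Measure.map_map (hm i) hset]
  exact (Measure.infinitePi_map_eval
    (fun i : ι => unitInterval.toNNReal p • Measure.dirac (i ∈ u) +
      unitInterval.toNNReal (unitInterval.symm p) • Measure.dirac False) i).symm

/-- Intersection with t acts coordinatewise on the product measure. -/
theorem map_inter_setBernoulli (t : Set ι) (ht : t ⊆ u) :
    (setBernoulli u p).map (· ∩ t) = setBernoulli t p := by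
  classical
  have hset : Measurable fun q : ι → Prop => {i | q i} := MeasurableEquiv.setOfPred.measurable
  have hinter : Measurable fun s : Set ι => s ∩ t := by
    refine measurable_set_iff.2 fun i => ?_
    exact (measurable_set_mem i).and measurable_const
  rw [setBernoulli_eq_map, setBernoulli_eq_map, Measure.map_map hinter hset]
  have h := Measure.infinitePi_map_pi
    (fun i : ι => unitInterval.toNNReal p • Measure.dirac (i ∈ u) +
      unitInterval.toNNReal (unitInterval.symm p) • Measure.dirac False)
    (f := fun i q => q ∧ i ∈ t) (fun i => measurable_id.and measurable_const)
  have h2 : (fun i : ι => (unitInterval.toNNReal p • Measure.dirac (i ∈ u) +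
      unitInterval.toNNReal (unitInterval.symm p) • Measure.dirac False).map
        (fun q => q ∧ i ∈ t)) = fun i : ι => unitInterval.toNNReal p • Measure.dirac (i ∈ t) +
      unitInterval.toNNReal (unitInterval.symm p) • Measure.dirac False := by
    funext i
    have hmi : Measurable fun q : Prop => q ∧ i ∈ t := measurable_id.and measurable_const
    rw [Measure.map_add _ _ hmi, Measure.map_smul, Measure.map_smul, Measure.map_dirac' hmi,
      Measure.map_dirac' hmi]
    have : (i ∈ u ∧ i ∈ t) = (i ∈ t) := propext ⟨fun h => h.2, fun h => ⟨ht h, h⟩⟩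
    rw [this, false_and]
  simp_rw [h2] at h
  rw [← h, Measure.map_map hset (by fun_prop)]
  rfl

/-- Each intersection is a function of the membership indicators of its own finite set. -/
theorem indepFun_inter_setBernoulli {s t : Finset ι} (hst : Disjoint s t) :
    IndepFun (fun a : Set ι => a ∩ s) (fun a : Set ι => a ∩ t) (setBernoulli u p) := by
  have key (s : Finset ι) : ∃ f : (s → Prop) → Set ι, Measurable f ∧
      (fun a : Set ι => a ∩ s) = f ∘ fun a (i : s) => (i : ι) ∈ a := by
    classical
    refine ⟨fun q => {i | ∃ h : i ∈ s, q ⟨i, h⟩}, Measurable.of_discrete, ?_⟩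
    funext a
    ext i
    simp [and_comm]
  obtain ⟨f, hf, hf'⟩ := key s
  obtain ⟨g, hg, hg'⟩ := key t
  have h := (iIndepFun_mem_setBernoulli u p).indepFun_finset s t hst
    (fun i => measurable_set_mem i)
  rw [hf', hg']
  exact h.comp hf hg

theorem setBernoulli_real_ncard_inter_eq [Countable ι] {t : Finset ι} (ht : (t : Set ι) ⊆ u)
    (k : ℕ) : (setBernoulli u p).real {a | (a ∩ t).ncard = k} = binomialWeight t.card p k := by
  have h := map_ncard_setBernoulli_real_singleton t.finite_toSet p k
  have hinter : Measurable fun s : Set ι => s ∩ t := by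
    refine measurable_set_iff.2 fun i => ?_
    exact (measurable_set_mem i).and measurable_const
  rw [← map_inter_setBernoulli u p t ht, Measure.map_map measurable_ncard hinter,
    map_measureReal_apply (measurable_ncard.comp hinter) (by simp), Set.ncard_coe_finset] at h
  exact h

theorem setBernoulli_real_ncard_inter_mem [Countable ι] {t : Finset ι} (ht : (t : Set ι) ⊆ u)
    (A : Finset ℕ) :
    (setBernoulli u p).real {a | (a ∩ t).ncard ∈ A} = ∑ k ∈ A, binomialWeight t.card p k := by
  have hinter : Measurable fun s : Set ι => s ∩ t := by
    refine measurable_set_iff.2 fun i => ?_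
    exact (measurable_set_mem i).and measurable_const
  have : {a : Set ι | (a ∩ t).ncard ∈ A} = ⋃ k ∈ A, {a : Set ι | (a ∩ t).ncard = k} := by
    ext a; simp
  rw [this, measureReal_biUnion_finset]
  · exact Finset.sum_congr rfl fun k _ => setBernoulli_real_ncard_inter_eq u p ht k
  · intro k _ l _ hkl
    refine Set.disjoint_left.2 fun a ha hb => hkl (ha.symm.trans hb)
  · intro k _
    exact (measurable_ncard.comp hinter) (measurableSet_singleton k)

theorem setBernoulli_real_le_ncard_inter [Countable ι] {t : Finset ι} (ht : (t : Set ι) ⊆ u)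
    (k : ℕ) :
    (setBernoulli u p).real {a | k ≤ (a ∩ t).ncard} = binomialTail t.card p k := by
  rw [binomialTail, ← setBernoulli_real_ncard_inter_mem u p ht]
  congr 1
  ext a
  have : (a ∩ t).ncard ≤ t.card := by
    rw [← Set.ncard_coe_finset]
    exact Set.ncard_le_ncard Set.inter_subset_right t.finite_toSet
  simp only [Set.mem_ofPred_eq, Finset.mem_Ico]
  omega

/-- The intersections of a random set with pairwise disjoint finite sets are independently
small. -/
theorem setBernoulli_real_forall_ncard_inter_lt [Finite ι] {κ : Type*} (E : κ → Finset ι)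
    (hE : Pairwise fun i j => Disjoint (E i) (E j)) (hu : ∀ i, (E i : Set ι) ⊆ u) {N : ℕ}
    (hN : ∀ i, (E i).card = N) (k : ℕ) (s : Finset κ) :
    (setBernoulli u p).real {a | ∀ i ∈ s, (a ∩ E i).ncard < k} =
      (1 - binomialTail N p k) ^ s.card := by
  classical
  induction s using Finset.induction_on with
  | empty => simp
  | insert i s hi ih =>
    have hd : Disjoint (E i) (s.biUnion E) := by
      rw [Finset.disjoint_biUnion_right]
      intro j hj
      exact hE (by rintro rfl; exact hi hj)
    have h := indepFun_inter_setBernoulli u p hd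
    have h2 := h.measureReal_inter_preimage
      (s := {b : Set ι | b.ncard < k}) (t := {b : Set ι | ∀ j ∈ s, (b ∩ E j).ncard < k})
      (Set.toFinite _).measurableSet (Set.toFinite _).measurableSet
    have e1 : (fun a : Set ι => a ∩ E i) ⁻¹' {b | b.ncard < k} =
        {a : Set ι | k ≤ (a ∩ E i).ncard}ᶜ := by
      ext a; simp
    have e2 : (fun a : Set ι => a ∩ (s.biUnion E : Finset ι)) ⁻¹'
        {b : Set ι | ∀ j ∈ s, (b ∩ E j).ncard < k} =
        {a : Set ι | ∀ i ∈ s, (a ∩ E i).ncard < k} := by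
      ext a
      simp only [Set.mem_preimage, Set.mem_ofPred_eq]
      refine forall₂_congr fun j hj => ?_
      rw [Set.inter_assoc, Set.inter_eq_self_of_subset_right (s := ((s.biUnion E : Finset ι) : Set ι))]
      exact_mod_cast Finset.subset_biUnion_of_mem E hj
    rw [e2, ih, e1, probReal_compl_eq_one_sub (Set.toFinite _).measurableSet,
      setBernoulli_real_le_ncard_inter u p (hu i), hN] at h2
    rw [Finset.card_insert_of_notMem hi, pow_succ, mul_comm, ← h2, ← e1]
    congr 1
    ext a
    simp

end SetBernoulli

/-! ### Pairs of large, close counts -/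

section Pair

variable {ι : Type*} [Finite ι] (u : Set ι) (p : unitInterval)

/-- Once the first count is k, the second lies among at most 2G + 1 values, all at least K, where
the weights of N trials are at most the one at K. Independence and summation over k give the bound;
each comparison with N trials costs a factor 2. -/
theorem setBernoulli_real_close_le {N K G : ℕ} (hp : (p : ℝ) ≤ 1 / 2)
    (hK : (N + 1) * (p : ℝ) ≤ K + 1) {s t : Finset ι} (hs : (s : Set ι) ⊆ u) (ht : (t : Set ι) ⊆ u)
    (hst : Disjoint s t) (hsN : s.card ≤ N)
    (hs2 : ∀ k, binomialWeight s.card p k ≤ 2 * binomialWeight N p k)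
    (ht2 : ∀ k, binomialWeight t.card p k ≤ 2 * binomialWeight N p k) :
    (setBernoulli u p).real {a | K ≤ (a ∩ s).ncard ∧ K ≤ (a ∩ t).ncard ∧
      (a ∩ s).ncard ≤ (a ∩ t).ncard + G ∧ (a ∩ t).ncard ≤ (a ∩ s).ncard + G} ≤
      4 * binomialTail N p K * (2 * G + 1) * binomialWeight N p K := by
  have h0 : 0 ≤ (p : ℝ) := p.2.1
  have hq := binomialWeight_nonneg (N := N) h0 (by linarith : (p : ℝ) ≤ 1)
  have hsub : {a : Set ι | K ≤ (a ∩ s).ncard ∧ K ≤ (a ∩ t).ncard ∧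
      (a ∩ s).ncard ≤ (a ∩ t).ncard + G ∧ (a ∩ t).ncard ≤ (a ∩ s).ncard + G} ⊆
      ⋃ k ∈ Finset.Ico K (N + 1), ({a : Set ι | (a ∩ s).ncard = k} ∩
        {a | (a ∩ t).ncard ∈ Finset.Icc (max K (k - G)) (k + G)}) := by
    rintro a ⟨h1, h2, h3, h4⟩
    have : (a ∩ s).ncard ≤ s.card := by
      rw [← Set.ncard_coe_finset]
      exact Set.ncard_le_ncard Set.inter_subset_right s.finite_toSet
    simp only [Set.mem_iUnion, Finset.mem_Ico]
    refine ⟨(a ∩ s).ncard, ⟨h1, by omega⟩, rfl, ?_⟩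
    simp only [Set.mem_ofPred_eq, Finset.mem_Icc]
    omega
  have hterm : ∀ k ∈ Finset.Ico K (N + 1), (setBernoulli u p).real
      ({a : Set ι | (a ∩ s).ncard = k} ∩
        {a | (a ∩ t).ncard ∈ Finset.Icc (max K (k - G)) (k + G)}) ≤
      binomialWeight N p k * (4 * (2 * G + 1) * binomialWeight N p K) := by
    intro k _
    have h := (indepFun_inter_setBernoulli u p hst).measureReal_inter_preimage
      (s := {b | b.ncard = k})
      (t := {b | b.ncard ∈ Finset.Icc (max K (k - G)) (k + G)})
      (Set.toFinite _).measurableSet (Set.toFinite _).measurableSet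
    refine h.trans_le ?_
    have e1 := setBernoulli_real_ncard_inter_eq u p hs k
    have e2 := setBernoulli_real_ncard_inter_mem u p ht (Finset.Icc (max K (k - G)) (k + G))
    have e3 : ∑ j ∈ Finset.Icc (max K (k - G)) (k + G), binomialWeight t.card p j ≤
        (2 * G + 1) * (2 * binomialWeight N p K) := by
      refine (Finset.sum_le_card_nsmul _ _ (2 * binomialWeight N p K) fun j hj => ?_).trans ?_
      · have := binomialWeight_antitone (N := N) h0 hp hK
          ((le_max_left _ _).trans (Finset.mem_Icc.1 hj).1)
        linarith [ht2 j]
      · rw [nsmul_eq_mul, Nat.card_Icc]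
        refine mul_le_mul_of_nonneg_right ?_ (by linarith [hq K])
        have : k + G + 1 - max K (k - G) ≤ 2 * G + 1 := by omega
        exact_mod_cast this
    calc _ = binomialWeight s.card p k *
          ∑ j ∈ Finset.Icc (max K (k - G)) (k + G), binomialWeight t.card p j := by
          rw [← e1, ← e2]; rfl
      _ ≤ (2 * binomialWeight N p k) * ((2 * G + 1) * (2 * binomialWeight N p K)) :=
          mul_le_mul (hs2 k) e3 (Finset.sum_nonneg fun j _ =>
            binomialWeight_nonneg h0 (by linarith) j) (by linarith [hq k])
      _ = _ := by ring
  calc _ ≤ _ := measureReal_mono hsub (measure_ne_top _ _)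
    _ ≤ _ := measureReal_biUnion_finset_le _ _
    _ ≤ _ := Finset.sum_le_sum hterm
    _ = _ := by rw [← Finset.sum_mul, binomialTail]; ring

/-- Two sets of the same size sharing at most one element rarely have large intersections with
a random set whose sizes are close to each other. -/
theorem setBernoulli_real_close_le_of_card_inter_le_one [DecidableEq ι] {N K G : ℕ}
    (hp : (p : ℝ) ≤ 1 / 2)
    (hK : (N + 1) * (p : ℝ) ≤ K + 1) {s t : Finset ι} (hs : (s : Set ι) ⊆ u) (ht : (t : Set ι) ⊆ u)
    (hst : (s ∩ t).card ≤ 1) (hsN : s.card = N) (htN : t.card = N) :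
    (setBernoulli u p).real {a | K + 1 ≤ (a ∩ s).ncard ∧ K + 1 ≤ (a ∩ t).ncard ∧
      (a ∩ s).ncard ≤ (a ∩ t).ncard + G ∧ (a ∩ t).ncard ≤ (a ∩ s).ncard + G} ≤
      4 * binomialTail N p K * (2 * G + 1) * binomialWeight N p K := by
  have h0 : 0 ≤ (p : ℝ) := p.2.1
  have hw : ∀ M, M ≤ N → N ≤ M + 1 → ∀ k, binomialWeight M p k ≤ 2 * binomialWeight N p k := by
    intro M h1 h2 k
    obtain rfl | rfl : N = M ∨ N = M + 1 := by omega
    · linarith [binomialWeight_nonneg (N := N) h0 (by linarith) k]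
    · exact binomialWeight_le_two_mul_succ h0 hp k
  have hc1 := Finset.card_sdiff_add_card_inter s t
  have hc2 := Finset.card_sdiff_add_card_inter t s
  rw [Finset.inter_comm] at hc2
  -- A shared element contributes equally to both counts. Deleting it preserves their difference and
  -- lowers the bound K + 1 to K at worst.
  have h := setBernoulli_real_close_le u p (N := N) (K := K) (G := G) hp hK (s := s \ t)
    (t := t \ s) (fun x hx => hs (Finset.mem_sdiff.1 hx).1)
    (fun x hx => ht (Finset.mem_sdiff.1 hx).1) disjoint_sdiff_sdiff (by omega)
    (hw _ (by omega) (by omega)) (hw _ (by omega) (by omega))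
  refine (measureReal_mono ?_).trans h
  have key (a : Set ι) (s t : Finset ι) : (a ∩ s).ncard =
      (a ∩ (s \ t : Finset ι)).ncard + (a ∩ (s ∩ t : Finset ι)).ncard := by
    rw [← Set.ncard_union_eq]
    · congr 1
      ext x
      simp only [Set.mem_inter_iff, Set.mem_union, Finset.mem_coe, Finset.mem_sdiff,
        Finset.mem_inter]
      tauto
    · rw [Set.disjoint_left]
      intro x hx hx'
      simp_all
  intro a ha
  have h1 := key a s t
  have h2 := key a t s
  rw [Finset.inter_comm] at h2
  have h3 : (a ∩ (s ∩ t : Finset ι)).ncard ≤ 1 := by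
    refine (Set.ncard_le_ncard Set.inter_subset_right (Finset.finite_toSet _)).trans ?_
    rwa [Set.ncard_coe_finset]
  simp only [Set.mem_ofPred_eq] at ha ⊢
  omega

end Pair

/-! ### Degrees as edge counts and the gap event -/

namespace Digraph

variable {V : Type*} [Fintype V]

/-- The edges starting at `v`, for `Sum.inl v`, or ending at `v`, for `Sum.inr v`, without
loops. -/
def incidentEdges [DecidableEq V] : V ⊕ V → Finset (V × V) :=
  Sum.elim (fun v => {v} ×ˢ Finset.univ.erase v) (fun v => Finset.univ.erase v ×ˢ {v})

theorem card_incidentEdges [DecidableEq V] {N : ℕ} (hN : Fintype.card V = N + 1) (i : V ⊕ V) :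
    (incidentEdges i).card = N := by
  rcases i with v | v <;>
    simp [incidentEdges, Finset.card_erase_of_mem, hN]

theorem incidentEdges_subset [DecidableEq V] (i : V ⊕ V) :
    (incidentEdges i : Set (V × V)) ⊆ {e : V × V | e.1 ≠ e.2} := by
  rcases i with v | v <;> rintro ⟨x, y⟩ h <;> simp [incidentEdges] at h <;> simp <;> grind

theorem card_incidentEdges_inter_le_one [DecidableEq V] {i j : V ⊕ V} (hij : i ≠ j) :
    (incidentEdges i ∩ incidentEdges j).card ≤ 1 := by
  rw [Finset.card_le_one]
  rintro ⟨x, y⟩ h ⟨x', y'⟩ h'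
  rcases i with v | v <;> rcases j with w | w <;> simp [incidentEdges] at h h' hij ⊢ <;> grind

theorem disjoint_incidentEdges_inl [DecidableEq V] {v w : V} (hvw : v ≠ w) :
    Disjoint (incidentEdges (Sum.inl v)) (incidentEdges (Sum.inl w)) := by
  rw [Finset.disjoint_left]
  rintro ⟨x, y⟩ h h'
  simp [incidentEdges] at h h'
  grind

theorem degree_ofEdgeSet [DecidableEq V] {a : Set (V × V)}
    (ha : a ⊆ {e : V × V | e.1 ≠ e.2}) (i : V ⊕ V) :
    Sum.elim (ofEdgeSet a).outDegree (ofEdgeSet a).inDegree i =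
      (a ∩ incidentEdges i).ncard := by
  rcases i with v | v
  · have : a ∩ incidentEdges (Sum.inl v) = Prod.mk v '' {w | (v, w) ∈ a} := by
      ext ⟨x, y⟩
      have := @ha (x, y)
      simp [incidentEdges] at this ⊢
      grind
    rw [this, Set.ncard_image_of_injective _ (Prod.mk_right_injective v)]
    rfl
  · have : a ∩ incidentEdges (Sum.inr v) = (fun w => (w, v)) '' {w | (w, v) ∈ a} := by
      ext ⟨x, y⟩
      have := @ha (x, y)
      simp [incidentEdges] at this ⊢
      grind
    rw [this, Set.ncard_image_of_injective _ (Prod.mk_left_injective v)]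
    rfl

/-- The two largest degrees are attained at different indices. -/
theorem exists_orderedDegree_eq [Nonempty V] (D : Digraph V) :
    ∃ i j : V ⊕ V, i ≠ j ∧ D.orderedDegree 1 = Sum.elim D.outDegree D.inDegree i ∧
      D.orderedDegree 2 = Sum.elim D.outDegree D.inDegree j ∧
      ∀ k, Sum.elim D.outDegree D.inDegree k ≤ D.orderedDegree 1 := by
  classical
  set d := Sum.elim D.outDegree D.inDegree with hd
  have hlen := D.length_degreeSequence
  have hpos : 0 < Fintype.card V := Fintype.card_pos
  have hms : ((Finset.univ : Finset V).val.map D.outDegree +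
      (Finset.univ : Finset V).val.map D.inDegree) =
      (Finset.univ : Finset (V ⊕ V)).val.map d := by
    rw [← Finset.univ_disjSum_univ, Finset.val_disjSum, Multiset.disjSum, Multiset.map_add,
      Multiset.map_map, Multiset.map_map]
    rfl
  have hseq : D.degreeSequence = ((Finset.univ : Finset (V ⊕ V)).val.map d).sort
      (fun a b => b ≤ a) := by
    rw [degreeSequence, hms]
  have hcoe : (D.degreeSequence : Multiset ℕ) = (Finset.univ : Finset (V ⊕ V)).val.map d := by
    rw [hseq, Multiset.sort_eq]
  have hsort : D.degreeSequence.Pairwise (fun a b => b ≤ a) := by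
    rw [hseq]; exact Multiset.pairwise_sort _ _
  unfold orderedDegree
  match h : D.degreeSequence with
  | [] => simp [h] at hlen
  | [_] => simp [h] at hlen; omega
  | x :: y :: l =>
    rw [h] at hcoe hsort
    have hx : x ∈ (Finset.univ : Finset (V ⊕ V)).val.map d := by rw [← hcoe]; simp
    obtain ⟨i, -, hi⟩ := Multiset.mem_map.1 hx
    -- Removing the index i, not just the value x, keeps the second index distinct even when the two
    -- degrees tie.
    have hrest : ((y :: l : List ℕ) : Multiset ℕ) =
        ((Finset.univ : Finset (V ⊕ V)).erase i).val.map d := by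
      have e : (Finset.univ : Finset (V ⊕ V)).val =
          i ::ₘ ((Finset.univ : Finset (V ⊕ V)).erase i).val := by
        rw [Finset.erase_val, Multiset.cons_erase (Finset.mem_univ i)]
      rw [e, Multiset.map_cons, hi, ← Multiset.cons_coe] at hcoe
      exact (Multiset.cons_inj_right x).1 hcoe
    have hy : y ∈ ((Finset.univ : Finset (V ⊕ V)).erase i).val.map d := by rw [← hrest]; simp
    obtain ⟨j, hj, hj'⟩ := Multiset.mem_map.1 hy
    refine ⟨i, j, ?_, ?_, ?_, ?_⟩
    · rintro rfl
      exact absurd hj (Finset.notMem_erase i Finset.univ)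
    · simp [hi]
    · simp [hj']
    · intro k
      have hk : d k ∈ (Finset.univ : Finset (V ⊕ V)).val.map d :=
        Multiset.mem_map_of_mem d (Finset.mem_univ k)
      rw [← hcoe] at hk
      rw [List.pairwise_cons] at hsort
      rcases List.mem_cons.1 (Multiset.mem_coe.1 hk) with h1 | h1
      · simp [h1]
      · simpa using hsort.1 _ h1

/-- The first subtracted term bounds the event `B` that no out-degree reaches K + 1 + G, the second
the union of the events `C` that two degrees above K are within G of each other. -/
theorem le_binomialRandom_real_gap (p : unitInterval) {N K G : ℕ} (hN : Fintype.card V = N + 1)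
    (hp : (p : ℝ) ≤ 1 / 2) (hK : (N + 1) * (p : ℝ) ≤ K + 1) :
    1 - (1 - binomialTail N p (K + 1 + G)) ^ (N + 1) -
      (2 * (N + 1)) ^ 2 * (4 * binomialTail N p K * (2 * G + 1) * binomialWeight N p K) ≤
    (binomialRandom V p).real
      {D | (G : ℝ) + 1 ≤ (D.orderedDegree 1 : ℝ) - (D.orderedDegree 2 : ℝ)} := by
  classical
  have : Nonempty V := Fintype.card_pos_iff.1 (by omega)
  set u : Set (V × V) := {e | e.1 ≠ e.2} with hu
  set μ := setBernoulli u p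
  set B : Set (Set (V × V)) :=
    {a | ∀ v ∈ (Finset.univ : Finset V), (a ∩ incidentEdges (Sum.inl v)).ncard < K + 1 + G}
  set C : (V ⊕ V) × (V ⊕ V) → Set (Set (V × V)) := fun ij =>
    {a | K + 1 ≤ (a ∩ incidentEdges ij.1).ncard ∧ K + 1 ≤ (a ∩ incidentEdges ij.2).ncard ∧
      (a ∩ incidentEdges ij.1).ncard ≤ (a ∩ incidentEdges ij.2).ncard + G ∧
      (a ∩ incidentEdges ij.2).ncard ≤ (a ∩ incidentEdges ij.1).ncard + G}
  set P := (Finset.univ : Finset (V ⊕ V)).offDiag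
  set S : Set (Digraph V) :=
    {D | (G : ℝ) + 1 ≤ (D.orderedDegree 1 : ℝ) - (D.orderedDegree 2 : ℝ)}
  have hB : μ.real B = (1 - binomialTail N p (K + 1 + G)) ^ (N + 1) := by
    rw [← hN]
    exact setBernoulli_real_forall_ncard_inter_lt u p (fun v : V => incidentEdges (Sum.inl v))
      (fun v w hvw => disjoint_incidentEdges_inl hvw) (fun v => incidentEdges_subset _)
      (fun v => card_incidentEdges hN _) _ Finset.univ
  have hb0 : 0 ≤ 4 * binomialTail N p K * (2 * G + 1) * binomialWeight N p K := by
    have h1 := binomialTail_nonneg (N := N) p.2.1 p.2.2 K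
    have h2 := binomialWeight_nonneg (N := N) p.2.1 p.2.2 K
    positivity
  have hC : μ.real (⋃ ij ∈ P, C ij) ≤
      (2 * (N + 1)) ^ 2 * (4 * binomialTail N p K * (2 * G + 1) * binomialWeight N p K) := by
    refine (measureReal_biUnion_finset_le _ _).trans ?_
    refine (Finset.sum_le_card_nsmul _ _ _ fun ij hij =>
      setBernoulli_real_close_le_of_card_inter_le_one u p hp hK (incidentEdges_subset _)
        (incidentEdges_subset _) (card_incidentEdges_inter_le_one (Finset.mem_offDiag.1 hij).2.2)
        (card_incidentEdges hN _) (card_incidentEdges hN _)).trans ?_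
    rw [nsmul_eq_mul]
    refine mul_le_mul_of_nonneg_right ?_ hb0
    have : P.card ≤ (2 * (N + 1)) ^ 2 := by
      rw [Finset.offDiag_card, Finset.card_univ, Fintype.card_sum, hN, ← two_mul, ← pow_two]
      exact Nat.sub_le _ _
    exact_mod_cast this
  -- Only almost everywhere: degrees equal the incident edge counts when there are no loops.
  have hincl : ∀ᵐ a ∂μ, a ∈ B ∪ (⋃ ij ∈ P, C ij) ∪ ofEdgeSet ⁻¹' S := by
    filter_upwards [setBernoulli_ae_subset (u := u) (p := p)] with a ha
    by_contra hcon
    simp only [Set.mem_union, not_or] at hcon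
    obtain ⟨⟨hcB, hcC⟩, hcS⟩ := hcon
    obtain ⟨i, j, hij, h1, h2, h3⟩ := exists_orderedDegree_eq (ofEdgeSet a)
    simp only [degree_ofEdgeSet ha] at h1 h2 h3
    simp only [B, Set.mem_ofPred_eq, not_forall, not_lt] at hcB
    obtain ⟨v, -, hv⟩ := hcB
    have hv' := h3 (Sum.inl v)
    have hnc : a ∉ C (i, j) := fun h => hcC <| Set.mem_biUnion (x := (i, j))
      (Finset.mem_coe.2 <| Finset.mem_offDiag.2 ⟨Finset.mem_univ _, Finset.mem_univ _, hij⟩) h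
    have hj := h3 j
    simp only [C, Set.mem_ofPred_eq] at hnc
    apply hcS
    change (G : ℝ) + 1 ≤ ((ofEdgeSet a).orderedDegree 1 : ℝ) - ((ofEdgeSet a).orderedDegree 2 : ℝ)
    -- If the second degree is at most K, the gap follows from the maximum being at least K + 1 + G.
    -- Otherwise both exceed K, and avoiding `C` separates them by more than G.
    have : G + 1 + (ofEdgeSet a).orderedDegree 2 ≤ (ofEdgeSet a).orderedDegree 1 := by omega
    have : ((G + 1 + (ofEdgeSet a).orderedDegree 2 : ℕ) : ℝ) ≤ (ofEdgeSet a).orderedDegree 1 := by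
      exact_mod_cast this
    push_cast at this
    linarith
  have h1 : 1 ≤ μ.real (B ∪ (⋃ ij ∈ P, C ij) ∪ ofEdgeSet ⁻¹' S) := by
    rw [← probReal_univ (μ := μ)]
    refine ENNReal.toReal_mono (measure_ne_top _ _) (measure_mono_ae ?_)
    filter_upwards [hincl] with a ha _ using ha
  have h2 := measureReal_union_le (μ := μ) (B ∪ (⋃ ij ∈ P, C ij)) (ofEdgeSet ⁻¹' S)
  have h3 := measureReal_union_le (μ := μ) B (⋃ ij ∈ P, C ij)
  have h4 : μ.real (ofEdgeSet ⁻¹' S) ≤ (binomialRandom V p).real S :=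
    ENNReal.toReal_mono (measure_ne_top _ _)
      (Measure.le_map_apply measurable_ofEdgeSet.aemeasurable S)
  linarith

end Digraph

/-! ### Choice of scales and the limit -/

theorem gap_scale_bounds {x y W : ℝ} (hx : 80 ≤ x) (hxW : 2 * W + 1 ≤ x) (hyx : x ^ 10 ≤ y) :
    ⌈y / (2 * x ^ 2)⌉₊ + 2 ≤ ⌊y / (80 * x)⌋₊ ∧ 2 * W ≤ ⌊y / (80 * x)⌋₊ ∧
      (2 * ⌈y / (2 * x ^ 2)⌉₊ + 1) / (⌊y / (80 * x)⌋₊ : ℝ) ≤ 640 / x := by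
  have hx0 : 0 < x := by linarith
  have hx1 : 1 ≤ x := by linarith
  have hx5 : x ^ 5 ≤ y := (pow_le_pow_right₀ hx1 (by norm_num)).trans hyx
  have hx3 : (80 : ℝ) ^ 3 ≤ x ^ 3 := by gcongr
  have hyx2 : 80 ^ 3 * x ^ 2 ≤ y := by nlinarith [pow_pos hx0 2]
  have hy0 : 0 < y := lt_of_lt_of_le (by positivity) hyx
  have hyx1 : 80 ^ 3 * x ≤ y := by nlinarith
  set G := ⌈y / (2 * x ^ 2)⌉₊
  set J := ⌊y / (80 * x)⌋₊
  have hG2 : (G : ℝ) < y / (2 * (x ^ 2)) + 1 := Nat.ceil_lt_add_one (by positivity)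
  have hJ2 : y / (80 * x) < J + 1 := Nat.lt_floor_add_one _
  have hJ3 : y / (160 * x) ≤ J := by
    have : y / (80 * x) = 2 * (y / (160 * x)) := by field_simp; norm_num
    have : 1 ≤ y / (160 * x) := by rw [le_div_iff₀ (by positivity)]; nlinarith
    linarith
  have hJ0 : (0 : ℝ) < J := lt_of_lt_of_le (by positivity) hJ3
  have hGJ : G + 2 ≤ J := by
    have h1 : y / (2 * (x ^ 2)) ≤ y / (160 * x) := by
      refine div_le_div_of_nonneg_left hy0.le (by positivity) ?_
      nlinarith
    have h2 : y / (80 * x) = 2 * (y / (160 * x)) := by field_simp; norm_num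
    have h3 : 4 ≤ y / (160 * x) := by rw [le_div_iff₀ (by positivity)]; nlinarith
    have : ((G + 2 : ℕ) : ℝ) ≤ J := by push_cast; linarith
    exact_mod_cast this
  have hWJ : 2 * W ≤ J := by
    have : x ≤ y / (160 * x) := by rw [le_div_iff₀ (by positivity)]; nlinarith
    linarith
  -- Rounding costs at most constant factors: 2G + 1 ≤ 4y/x² and J ≥ y/(160x), whence 640 = 4 · 160.
  have hratio : (2 * G + 1) / (J : ℝ) ≤ 640 / x := by
    rw [div_le_div_iff₀ hJ0 hx0]
    have h1 : (2 * G + 1 : ℝ) ≤ 4 * (y / x ^ 2) := by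
      have e : y / x ^ 2 = 2 * (y / (2 * (x ^ 2))) := by field_simp
      have : 1 ≤ y / x ^ 2 := by rw [le_div_iff₀ (by positivity)]; nlinarith [pow_pos hx0 2]
      linarith
    calc (2 * G + 1 : ℝ) * x ≤ 4 * (y / x ^ 2) * x := by gcongr
      _ = 640 * (y / (160 * x)) := by field_simp; norm_num
      _ ≤ 640 * J := by gcongr
  exact ⟨hGJ, hWJ, hratio⟩

theorem union_bound_le {a T q W J G x : ℝ} (ha : 0 < a) (hJ : 0 < J) (hG : 0 ≤ G) (hW : 0 ≤ W)
    (hq0 : 0 ≤ q) (hT : T ≤ 3 * W / a) (hq : J * q ≤ 6 * W / a)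
    (hratio : (2 * G + 1) / J ≤ 640 / x) :
    (2 * a) ^ 2 * (4 * T * (2 * G + 1) * q) ≤ 184320 * W ^ 2 / x := by
  have hq' : q ≤ 6 * W / a / J := by
    rw [le_div_iff₀ hJ]; linarith
  calc (2 * a) ^ 2 * (4 * T * (2 * G + 1) * q)
      ≤ (2 * a) ^ 2 * (4 * (3 * W / a) * (2 * G + 1) * (6 * W / a / J)) := by gcongr
    _ = 288 * W ^ 2 * ((2 * G + 1) / J) := by field_simp; ring
    _ ≤ 288 * W ^ 2 * (640 / x) := by gcongr
    _ = 184320 * W ^ 2 / x := by ring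

theorem one_sub_pow_le_exp_neg {N : ℕ} {T W : ℝ} (hT : T ≤ 1) (hW : W / (N + 1) ≤ T) :
    (1 - T) ^ (N + 1) ≤ Real.exp (-W) := by
  calc (1 - T) ^ (N + 1) ≤ Real.exp (-T) ^ (N + 1) :=
        pow_le_pow_left₀ (by linarith) (Real.one_sub_le_exp_neg _) _
    _ = Real.exp (-((N + 1) * T)) := by rw [← Real.exp_nat_mul]; push_cast; congr 1; ring
    _ ≤ Real.exp (-W) := by
        rw [div_le_iff₀ (by positivity)] at hW
        rw [Real.exp_le_exp]; linarith

namespace Digraph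

theorem le_binomialRandom_real_gap_of_log {n : ℕ} (p : unitInterval) {W : ℝ} (hW : 1 ≤ W)
    (hx : 80 ≤ √(Real.log n)) (hxW : 2 * W + 1 ≤ √(Real.log n))
    (hnp : Real.log n ^ 10 / n ≤ (p : ℝ)) (hp : (p : ℝ) ≤ 1 / 2) :
    1 - Real.exp (-W) - 184320 * W ^ 2 / √(Real.log n) ≤
    (binomialRandom (Fin n) p).real {D : Digraph (Fin n) |
      √(n * (p : ℝ)) / (2 * Real.log n) ≤ (D.orderedDegree 1 : ℝ) - (D.orderedDegree 2 : ℝ)} := by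
  obtain ⟨N, rfl⟩ : ∃ N, n = N + 1 := by
    refine Nat.exists_eq_succ_of_ne_zero ?_
    rintro rfl
    norm_num at hx
  set ℓ := Real.log ((N + 1 : ℕ) : ℝ)
  set x := √ℓ
  have hℓ : 0 ≤ ℓ := Real.log_natCast_nonneg _
  have hxℓ : x ^ 2 = ℓ := Real.sq_sqrt hℓ
  have hN : (0 : ℝ) < N + 1 := by positivity
  have hμ : ℓ ^ 10 ≤ (N + 1) * (p : ℝ) := by
    push_cast at hnp
    rwa [div_le_iff₀ hN, mul_comm] at hnp
  have hp0 : 0 < (p : ℝ) := by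
    have h : 0 < (N + 1) * (p : ℝ) := lt_of_lt_of_le (by rw [← hxℓ]; positivity) hμ
    exact pos_of_mul_pos_right h hN.le
  set y := √((N + 1) * (p : ℝ)) with hy
  have hyμ : y ^ 2 = (N + 1) * (p : ℝ) := Real.sq_sqrt (by positivity)
  have hyx : x ^ 10 ≤ y := by
    refine Real.le_sqrt_of_sq_le (le_trans (le_of_eq ?_) hμ)
    rw [← hxℓ]; ring
  have hx0 : 0 < x := by linarith
  have hx1 : 1 ≤ x := by linarith
  have hx5 : x ^ 5 ≤ y := (pow_le_pow_right₀ hx1 (by norm_num)).trans hyx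
  have hx4 : (80 : ℝ) ^ 3 ≤ x ^ 3 := by gcongr
  have hyx2 : 80 ^ 3 * x ^ 2 ≤ y := by nlinarith [pow_pos hx0 2]
  have hy0 : 0 < y := lt_of_lt_of_le (by positivity) hyx
  have hyx1 : 80 ^ 3 * x ≤ y := by nlinarith
  -- With y = √(np) and x = √(log n), G is the target gap rounded up. J is the largest window
  -- allowed by 80Jr ≤ y² for r = yx = √(np log n).
  set G := ⌈y / (2 * ℓ)⌉₊
  set J := ⌊y / (80 * x)⌋₊
  have hG : y / (2 * ℓ) ≤ G := Nat.le_ceil _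
  have hJ : (J : ℝ) ≤ y / (80 * x) := Nat.floor_le (by positivity)
  obtain ⟨hGJ, hWJ, hratio⟩ : G + 2 ≤ J ∧ 2 * W ≤ J ∧ (2 * G + 1) / (J : ℝ) ≤ 640 / x := by
    have h := gap_scale_bounds hx hxW hyx
    rwa [hxℓ] at h
  have hlog : Real.log ((N : ℝ) + 1) = ℓ := by simp [ℓ]
  obtain ⟨K, hK, hK1, hK2, hK3⟩ := exists_binomial_threshold (N := N) hp0 hp
    (r := y * x) (W := W) (G := G) (J := J) (by rw [hlog, ← hxℓ]; nlinarith)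
    (by rw [hlog, mul_pow, hyμ, hxℓ]) (by nlinarith) (by rw [← hyμ]; nlinarith)
    (by
      rw [← hyμ]
      calc 80 * J * (y * x) ≤ 80 * (y / (80 * x)) * (y * x) := by gcongr
        _ = y ^ 2 := by field_simp)
    hGJ hW hWJ
  have hp1 : (p : ℝ) ≤ 1 := p.2.2
  have hmain := le_binomialRandom_real_gap (V := Fin (N + 1)) p (N := N) (K := K) (G := G)
    (by simp) hp hK
  have hq0 := binomialWeight_nonneg (N := N) hp0.le hp1 K
  have hT1 : binomialTail N p (K + 1 + G) ≤ 1 := by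
    rw [← sum_binomialWeight N p]
    refine (binomialTail_anti hp0.le hp1 (Nat.zero_le _)).trans (le_of_eq ?_)
    rw [binomialTail, Finset.range_eq_Ico]
  have hA := one_sub_pow_le_exp_neg hT1 hK1
  have hB := union_bound_le hN (x := x) (G := G) (J := J) (by linarith) (Nat.cast_nonneg G)
    (by linarith) hq0 hK2 hK3 hratio
  refine le_trans (by linarith) (hmain.trans (measureReal_mono (fun D hD => ?_)))
  simp only [Set.mem_ofPred_eq] at hD ⊢
  push_cast
  linarith

end Digraph

theorem proposition4p8 (p : ℕ → unitInterval)
    (hp : ∀ᶠ n : ℕ in Filter.atTop,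
      Real.log n ^ 10 / n ≤ (p n : ℝ) ∧ (p n : ℝ) ≤ 1 / 2) :
    Filter.Tendsto
      (fun n : ℕ => (Digraph.binomialRandom (Fin n) (p n)).real
        {D : Digraph (Fin n) |
          Real.sqrt (n * (p n : ℝ)) / (2 * Real.log n) ≤
            (D.orderedDegree 1 : ℝ) - (D.orderedDegree 2 : ℝ)})
      Filter.atTop (nhds 1) := by
  refine tendsto_order.2 ⟨fun a ha => ?_, fun b hb =>
    Filter.Eventually.of_forall fun n => measureReal_le_one.trans_lt hb⟩
  have hexp : Filter.Tendsto (fun W : ℝ => 1 - Real.exp (-W)) Filter.atTop (nhds (1 - 0)) :=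
    tendsto_const_nhds.sub Real.tendsto_exp_neg_atTop_nhds_zero
  rw [sub_zero] at hexp
  -- W is fixed before n grows, so W²/√(log n) still tends to 0.
  obtain ⟨W, hWa, hW⟩ := ((hexp.eventually (lt_mem_nhds ha)).and
    (Filter.eventually_ge_atTop 1)).exists
  have hsqrt : Filter.Tendsto (fun n : ℕ => √(Real.log n)) Filter.atTop Filter.atTop :=
    Real.tendsto_sqrt_atTop.comp (Real.tendsto_log_atTop.comp tendsto_natCast_atTop_atTop)
  have hlim : Filter.Tendsto (fun n : ℕ => 1 - Real.exp (-W) - 184320 * W ^ 2 / √(Real.log n))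
      Filter.atTop (nhds (1 - Real.exp (-W) - 0)) :=
    tendsto_const_nhds.sub (hsqrt.const_div_atTop _)
  rw [sub_zero] at hlim
  filter_upwards [hp, hlim.eventually (lt_mem_nhds hWa), hsqrt.eventually_ge_atTop 80,
    hsqrt.eventually_ge_atTop (2 * W + 1)] with n hn h1 h2 h3
  exact h1.trans_le (Digraph.le_binomialRandom_real_gap_of_log (p n) hW h2 h3 hn.1 hn.2)
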